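/- Let $n\ge 1$ and $q\ge 1$ be integers. For integers $p_1,\dots,p_n$ with $\gcd(p_1,\dots,p_n,q)=1$ let $g\in O(2n)$ be the block diagonal matrix with blocks $R(p_1/q),\dots,R(p_n/q)$, where $R(\theta)=\begin{pmatrix}\cos 2\pi\theta & \sin 2\pi\theta\\ -\sin 2\pi\theta & \cos 2\pi\theta\end{pmatrix}$, let $G$ be the cyclic group (of order $q$) generated by $g$, and let the (possibly singular) lens space $L(q:p_1,\dots,p_n)=S^{2n-1}/G$ be the quotient Riemannian orbifold of the unit sphere with its round metric of constant curvature one. (An isometry of such orbifolds is a homeomorphism of the underlying spaces that lifts, near every point, to a Riemannian isometry between open subsets of $S^{2n-1}$.) Let $p_1,\dots,p_n$ and $s_1,\dots,s_n$ be integers with $\gcd(p_1,\dots,p_n,q)=\gcd(s_1,\dots,s_n,q)=1$. Then $L(q:p_1,\dots,p_n)$ and $L(q:s_1,\dots,s_n)$ are isometric if and only if there are an integer $l$ coprime to $q$ and signs $e_1,\dots,e_n\in\{-1,1\}$ such that $(p_1,\dots,p_n)$ is a permutation of $(e_1 l s_1,\dots,e_n l s_n)$ modulo $q$. -/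

import Mathlib

open scoped Manifold ContDiff

noncomputable section

namespace LensSpace

/-- Euclidean space `ℝ²ⁿ`; the coordinate `(a, j)` is the `a`-th coordinate in the `j`-th of the
`n` coordinate planes. -/
abbrev E (n : ℕ) : Type := EuclideanSpace ℝ (Fin 2 × Fin n)

/-- The unit sphere `S²ⁿ⁻¹` in `ℝ²ⁿ`. -/
abbrev S (n : ℕ) : Type := Metric.sphere (0 : E n) 1

/-- The orthogonal group `O(2n)`. -/
abbrev O (n : ℕ) : Type := Matrix.orthogonalGroup (Fin 2 × Fin n) ℝ

/-- Makes Mathlib's smooth structure on the sphere available for `S n`. -/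
instance finrank_E (n : ℕ) [NeZero n] : Fact (Module.finrank ℝ (E n) = (2 * n - 1) + 1) :=
  ⟨by
    have : n ≠ 0 := NeZero.ne n
    simp only [finrank_euclideanSpace, Fintype.card_prod, Fintype.card_fin]
    omega⟩

theorem norm_toEuclideanLin {n : ℕ} (A : O n) (x : E n) :
    ‖Matrix.toEuclideanLin (A : Matrix (Fin 2 × Fin n) (Fin 2 × Fin n) ℝ) x‖ = ‖x‖ := by
  have h : (A : Matrix (Fin 2 × Fin n) (Fin 2 × Fin n) ℝ).transpose * A.1 = 1 :=
    (Matrix.mem_orthogonalGroup_iff' _ _).1 A.2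
  have key : inner ℝ (Matrix.toEuclideanLin A.1 x) (Matrix.toEuclideanLin A.1 x)
      = inner ℝ x x := by
    simp only [EuclideanSpace.inner_eq_star_dotProduct, star_trivial,
      Matrix.toLpLin_apply, Matrix.dotProduct_mulVec, Matrix.vecMul_mulVec]
    simp [h]
  rw [real_inner_self_eq_norm_sq, real_inner_self_eq_norm_sq] at key
  exact (sq_eq_sq₀ (norm_nonneg _) (norm_nonneg _)).1 key

/-- The action of `O(2n)` on the sphere `S²ⁿ⁻¹` by matrix-vector multiplication. -/
instance (n : ℕ) : MulAction (O n) (S n) where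
  smul A x := ⟨Matrix.toEuclideanLin A.1 x.1, by
    have := norm_toEuclideanLin A x.1
    simp_all⟩
  one_smul x := by
    apply Subtype.ext
    change Matrix.toEuclideanLin (1 : Matrix (Fin 2 × Fin n) (Fin 2 × Fin n) ℝ) x.1 = x.1
    simp
  mul_smul A B x := by
    apply Subtype.ext
    change Matrix.toEuclideanLin (A.1 * B.1) x.1
      = Matrix.toEuclideanLin A.1 (Matrix.toEuclideanLin B.1 x.1)
    simp

/-- The quotient `S²ⁿ⁻¹ / G` by a subgroup `G` of `O(2n)`, with the quotient topology. -/
def SphereQuotient {n : ℕ} (G : Subgroup (O n)) : Type := MulAction.orbitRel.Quotient G (S n)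

instance {n : ℕ} (G : Subgroup (O n)) : TopologicalSpace (SphereQuotient G) :=
  inferInstanceAs (TopologicalSpace (Quotient (MulAction.orbitRel G (S n))))

/-- The covering projection `π : S²ⁿ⁻¹ → S²ⁿ⁻¹ / G`. -/
def proj {n : ℕ} (G : Subgroup (O n)) (x : S n) : SphereQuotient G :=
  Quotient.mk (MulAction.orbitRel G (S n)) x

/-- The round metric of constant curvature one on `S²ⁿ⁻¹`, i.e. the Riemannian metric induced by
the inclusion in `ℝ²ⁿ`. -/
def roundMetric {n : ℕ} [NeZero n] (x : S n) (v w : TangentSpace (𝓡 (2 * n - 1)) x) : ℝ :=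
  inner ℝ
    (show E n from mfderiv (𝓡 (2 * n - 1)) 𝓘(ℝ, E n) (Subtype.val : S n → E n) x v)
    (show E n from mfderiv (𝓡 (2 * n - 1)) 𝓘(ℝ, E n) (Subtype.val : S n → E n) x w)

/-- A Riemannian isometry between two open subsets (`F.source` and `F.target`) of the round sphere:
a smooth diffeomorphism whose differential preserves the round metric. -/
structure IsLocalRiemannianIsometry {n : ℕ} [NeZero n]
    (F : OpenPartialHomeomorph (S n) (S n)) : Prop where
  contMDiffOn : ContMDiffOn (𝓡 (2 * n - 1)) (𝓡 (2 * n - 1)) ∞ F F.source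
  contMDiffOn_symm : ContMDiffOn (𝓡 (2 * n - 1)) (𝓡 (2 * n - 1)) ∞ F.symm F.target
  metric_eq : ∀ y ∈ F.source, ∀ v w : TangentSpace (𝓡 (2 * n - 1)) y,
    roundMetric (F y) (mfderiv (𝓡 (2 * n - 1)) (𝓡 (2 * n - 1)) F y v)
      (mfderiv (𝓡 (2 * n - 1)) (𝓡 (2 * n - 1)) F y w) = roundMetric y v w

/-- An isometry between the Riemannian orbifolds `S²ⁿ⁻¹ / G` and `S²ⁿ⁻¹ / G'` (`G`, `G'` finite):
a homeomorphism of the underlying spaces that lifts, near every point, to a Riemannian isometry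
between orbifold charts. The charts of `S²ⁿ⁻¹ / G` are open subsets of the sphere with the
restriction of `π`, and they carry the round metric. -/
structure OrbifoldIsometry {n : ℕ} [NeZero n] (G G' : Subgroup (O n)) where
  toHomeomorph : SphereQuotient G ≃ₜ SphereQuotient G'
  exists_lift : ∀ x : S n, ∃ F : OpenPartialHomeomorph (S n) (S n),
    x ∈ F.source ∧ IsLocalRiemannianIsometry F ∧
      ∀ y ∈ F.source, proj G' (F y) = toHomeomorph (proj G y)

/-- `R(θ)`, a rotation by the angle `2πθ`. -/
def R (θ : ℝ) : Matrix (Fin 2) (Fin 2) ℝ :=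
  !![Real.cos (2 * Real.pi * θ), Real.sin (2 * Real.pi * θ);
    -Real.sin (2 * Real.pi * θ), Real.cos (2 * Real.pi * θ)]

theorem R_mul_transpose (θ : ℝ) : R θ * (R θ).transpose = 1 := by
  have h := Real.sin_sq_add_cos_sq (2 * Real.pi * θ)
  ext i j
  fin_cases i <;> fin_cases j <;> simp [R, Matrix.mul_apply, Fin.sum_univ_two] <;> linarith

/-- The block diagonal orthogonal matrix `g` with blocks `R(p₁/q), …, R(pₙ/q)`. -/
def generator {n : ℕ} (q : ℕ) (p : Fin n → ℤ) : O n :=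
  ⟨Matrix.blockDiagonal fun i => R ((p i : ℝ) / (q : ℝ)), by
    rw [Matrix.mem_orthogonalGroup_iff, Matrix.blockDiagonal_transpose,
      ← Matrix.blockDiagonal_mul]
    simp only [R_mul_transpose]
    exact Matrix.blockDiagonal_one⟩

/-- The cyclic group `G` generated by `g`; the lens space `L(q : p₁, …, pₙ)` is `S²ⁿ⁻¹ / G`. -/
def group {n : ℕ} (q : ℕ) (p : Fin n → ℤ) : Subgroup (O n) := Subgroup.zpowers (generator q p)

/-- The lens spaces `L(q : p₁, …, pₙ)` and `L(q : s₁, …, sₙ)` are isometric. -/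
def Isometric {n : ℕ} [NeZero n] (q : ℕ) (p s : Fin n → ℤ) : Prop :=
  Nonempty (OrbifoldIsometry (group q p) (group q s))

end LensSpace

end

open scoped Manifold ContDiff

noncomputable section

namespace LensSpace

open Metric Filter Topology

/-! An isometry of the quotients forces their groups to be conjugate in `O(2n)`, and conjugacy of
the generators is read off from rotation angles. A Riemannian isometry between open pieces of the
sphere preserves chordal distances near each point
(`IsLocalRiemannianIsometry.exists_ball_dist_eq`), hence is there the restriction of an orthogonal
map (`exists_orthogonal_of_dist_eq`). Orthogonal maps lifting the same map on an open set differ by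
one element of the finite group `G'` (`exists_eq_mul_of_isOpen`). As the sphere is connected, a
single orthogonal `A` therefore lifts the whole isometry (`OrbifoldIsometry.exists_orthogonal`), and
`A` conjugates `G` to `G'`. So `A` takes the generator for `p` to the `l`-th power of the generator
for `s`, which is the block rotation for `l • s`. Since this power generates `G'`, the gcd condition
makes `l` coprime to `q`. The cosines of the angles, with multiplicity, are conjugation invariants;
they determine the angles up to order and sign. Conversely, permuting the coordinate planes and
reflecting some of them conjugates the groups, and any conjugating orthogonal map descends to an
isometry. -/

/-! ### Local Riemannian isometries preserve chordal distances -/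

/-- On a curve of unit vectors, the derivative is orthogonal to the position. -/
theorem inner_eq_zero_of_hasDerivAt {V : Type*} [NormedAddCommGroup V] [InnerProductSpace ℝ V]
    {u : ℝ → V} {u' : V} {t : ℝ} (h : HasDerivAt u u' t) (hu : ∀ᶠ s in 𝓝 t, ‖u s‖ = 1) :
    inner ℝ (u t) u' = 0 := by
  have h1 := h.norm_sq
  have h2 : HasDerivAt (fun s => ‖u s‖ ^ 2) 0 t := by
    refine (hasDerivAt_const t (1 : ℝ)).congr_of_eventuallyEq ?_
    filter_upwards [hu] with s hs
    simp [hs]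
  have := h1.unique h2
  linarith

/-- Speed in polar coordinates, by Pythagoras: only the norm of `u'` enters, so replacing the
angular curve by one of equal speed changes nothing. -/
theorem norm_sq_add_smul_of_orthogonal {V : Type*} [NormedAddCommGroup V] [InnerProductSpace ℝ V]
    {u u' : V} (r r' : ℝ) (hu : ‖u‖ = 1) (h : inner ℝ u u' = 0) :
    ‖r • u' + r' • u‖ ^ 2 = r ^ 2 * ‖u'‖ ^ 2 + r' ^ 2 := by
  rw [norm_add_sq_real, inner_smul_left, inner_smul_right, real_inner_comm, h, norm_smul,
    norm_smul, hu]
  simp [mul_pow]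

theorem IsLocalRiemannianIsometry.mdifferentiableAt {n : ℕ} [NeZero n]
    {F : OpenPartialHomeomorph (S n) (S n)} (hF : IsLocalRiemannianIsometry F) {x : S n}
    (hx : x ∈ F.source) : MDifferentiableAt (𝓡 (2 * n - 1)) (𝓡 (2 * n - 1)) F x :=
  (hF.contMDiffOn.contMDiffAt (F.open_source.mem_nhds hx)).mdifferentiableAt (by simp)

theorem mdifferentiableAt_val {n : ℕ} [NeZero n] (x : S n) :
    MDifferentiableAt (𝓡 (2 * n - 1)) 𝓘(ℝ, E n) (Subtype.val : S n → E n) x :=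
  ((contMDiff_coe_sphere (m := ∞)) x).mdifferentiableAt (by simp)

theorem IsLocalRiemannianIsometry.symm {n : ℕ} [NeZero n]
    {F : OpenPartialHomeomorph (S n) (S n)} (hF : IsLocalRiemannianIsometry F) :
    IsLocalRiemannianIsometry F.symm where
  contMDiffOn := hF.contMDiffOn_symm
  contMDiffOn_symm := by simpa using hF.contMDiffOn
  metric_eq := by
    intro y hy v w
    have hy' : y ∈ F.target := hy
    have hz : F.symm y ∈ F.source := F.map_target hy'
    have hd : MDifferentiableAt (𝓡 (2 * n - 1)) (𝓡 (2 * n - 1)) F.symm y :=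
      (hF.contMDiffOn_symm.contMDiffAt (F.open_target.mem_nhds hy')).mdifferentiableAt (by simp)
    have hc := (hF.mdifferentiableAt hz).hasMFDerivAt.comp y hd.hasMFDerivAt
    have hid : HasMFDerivAt (𝓡 (2 * n - 1)) (𝓡 (2 * n - 1)) (F ∘ F.symm) y
        (ContinuousLinearMap.id ℝ (TangentSpace (𝓡 (2 * n - 1)) y)) := by
      refine (hasMFDerivAt_id y).congr_of_eventuallyEq ?_
      filter_upwards [F.open_target.mem_nhds hy'] with z hz
      exact F.right_inv hz
    have heq := hasMFDerivAt_unique hc hid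
    have happ : ∀ v : TangentSpace (𝓡 (2 * n - 1)) y,
        mfderiv (𝓡 (2 * n - 1)) (𝓡 (2 * n - 1)) F (F.symm y)
          (mfderiv (𝓡 (2 * n - 1)) (𝓡 (2 * n - 1)) F.symm y v) = v :=
      fun v => congrArg (fun L => L v) heq
    have := hF.metric_eq _ hz (mfderiv (𝓡 (2 * n - 1)) (𝓡 (2 * n - 1)) F.symm y v)
      (mfderiv (𝓡 (2 * n - 1)) (𝓡 (2 * n - 1)) F.symm y w)
    rw [happ, happ, F.right_inv hy'] at this
    exact this.symm

/-- A local Riemannian isometry preserves the speed of curves. -/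
theorem IsLocalRiemannianIsometry.exists_hasDerivAt {n : ℕ} [NeZero n]
    {F : OpenPartialHomeomorph (S n) (S n)} (hF : IsLocalRiemannianIsometry F)
    {c : ℝ → S n} {t : ℝ} (hc : MDifferentiableAt 𝓘(ℝ, ℝ) (𝓡 (2 * n - 1)) c t)
    (ht : c t ∈ F.source) :
    ∃ u' v' : E n, HasDerivAt (fun s => (F (c s)).1) u' t ∧ HasDerivAt (fun s => (c s).1) v' t ∧
      ‖u'‖ = ‖v'‖ := by
  have h1 := (mdifferentiableAt_val (c t)).hasMFDerivAt.comp t hc.hasMFDerivAt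
  have h2 := (mdifferentiableAt_val (F (c t))).hasMFDerivAt.comp t
    ((hF.mdifferentiableAt ht).hasMFDerivAt.comp t hc.hasMFDerivAt)
  obtain ⟨L₁, hL₁, hd₁⟩ : ∃ L : ℝ →L[ℝ] E n, L 1 = mfderiv (𝓡 (2 * n - 1)) 𝓘(ℝ, E n)
      (Subtype.val : S n → E n) (c t) (mfderiv 𝓘(ℝ, ℝ) (𝓡 (2 * n - 1)) c t (1 : ℝ)) ∧
      HasFDerivAt (fun s => (c s).1) L t := ⟨_, rfl, hasMFDerivAt_iff_hasFDerivAt.1 h1⟩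
  obtain ⟨L₂, hL₂, hd₂⟩ : ∃ L : ℝ →L[ℝ] E n, L 1 = mfderiv (𝓡 (2 * n - 1)) 𝓘(ℝ, E n)
      (Subtype.val : S n → E n) (F (c t)) (mfderiv (𝓡 (2 * n - 1)) (𝓡 (2 * n - 1)) F (c t)
        (mfderiv 𝓘(ℝ, ℝ) (𝓡 (2 * n - 1)) c t (1 : ℝ))) ∧
      HasFDerivAt (fun s => (F (c s)).1) L t := ⟨_, rfl, hasMFDerivAt_iff_hasFDerivAt.1 h2⟩
  refine ⟨L₂ 1, L₁ 1, hd₂.hasDerivAt, hd₁.hasDerivAt, ?_⟩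
  rw [hL₁, hL₂]
  have h3 := hF.metric_eq _ ht (mfderiv 𝓘(ℝ, ℝ) (𝓡 (2 * n - 1)) c t (1 : ℝ))
    (mfderiv 𝓘(ℝ, ℝ) (𝓡 (2 * n - 1)) c t (1 : ℝ))
  unfold roundMetric at h3
  erw [real_inner_self_eq_norm_sq, real_inner_self_eq_norm_sq] at h3
  exact (sq_eq_sq₀ (norm_nonneg _) (norm_nonneg _)).1 h3

theorem segment_ne_zero {V : Type*} [NormedAddCommGroup V] [NormedSpace ℝ V] {x y : V}
    (hx : ‖x‖ = 1) (hy : ‖y‖ = 1) (hxy : x + y ≠ 0) (t : ℝ) : (1 - t) • x + t • y ≠ 0 := by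
  intro h
  have h1 : (1 - t) • x = -(t • y) := eq_neg_of_add_eq_zero_left h
  have h2 := congrArg norm h1
  rw [norm_neg, norm_smul, norm_smul, hx, hy, mul_one, mul_one, Real.norm_eq_abs,
    Real.norm_eq_abs, abs_eq_abs] at h2
  have ht : t = 1 / 2 := by rcases h2 with h2 | h2 <;> linarith
  apply hxy
  rw [ht, show (1 - 1 / 2 : ℝ) = 1 / 2 by norm_num, ← smul_add, smul_eq_zero] at h
  exact h.resolve_left (by norm_num)

/-- The radial projection to the sphere of the segment from `x` to `y`. -/
def arc {n : ℕ} (x y : S n) (hxy : (x : E n) + y ≠ 0) (t : ℝ) : S n :=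
  ⟨‖(1 - t) • (x : E n) + t • (y : E n)‖⁻¹ • ((1 - t) • (x : E n) + t • (y : E n)), by
    have := segment_ne_zero (norm_eq_of_mem_sphere x) (norm_eq_of_mem_sphere y) hxy t
    rw [mem_sphere_zero_iff_norm, norm_smul, norm_inv, norm_norm]
    exact inv_mul_cancel₀ (norm_ne_zero_iff.2 this)⟩

theorem norm_smul_arc {n : ℕ} (x y : S n) (hxy : (x : E n) + y ≠ 0) (t : ℝ) :
    ‖(1 - t) • (x : E n) + t • (y : E n)‖ • (arc x y hxy t : E n)
      = (1 - t) • (x : E n) + t • (y : E n) := by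
  have := segment_ne_zero (norm_eq_of_mem_sphere x) (norm_eq_of_mem_sphere y) hxy t
  exact smul_inv_smul₀ (norm_ne_zero_iff.2 this) _

theorem arc_zero {n : ℕ} (x y : S n) (hxy : (x : E n) + y ≠ 0) : arc x y hxy 0 = x := by
  apply Subtype.ext
  simp [arc]

theorem arc_one {n : ℕ} (x y : S n) (hxy : (x : E n) + y ≠ 0) : arc x y hxy 1 = y := by
  apply Subtype.ext
  simp [arc]

theorem contDiff_segment {V : Type*} [NormedAddCommGroup V] [NormedSpace ℝ V] (x y : V) :
    ContDiff ℝ ∞ fun t : ℝ => (1 - t) • x + t • y := by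
  fun_prop

theorem contMDiff_arc {n : ℕ} [NeZero n] (x y : S n) (hxy : (x : E n) + y ≠ 0) :
    ContMDiff 𝓘(ℝ, ℝ) (𝓡 (2 * n - 1)) ∞ (arc x y hxy) := by
  refine ContMDiff.codRestrict_sphere (n := 2 * n - 1)
    (f := fun t => ‖(1 - t) • (x : E n) + t • (y : E n)‖⁻¹ •
      ((1 - t) • (x : E n) + t • (y : E n))) ?_ (fun t => (arc x y hxy t).2)
  rw [contMDiff_iff_contDiff]
  have h := segment_ne_zero (norm_eq_of_mem_sphere x) (norm_eq_of_mem_sphere y) hxy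
  exact (((contDiff_segment _ _).norm ℝ h).inv fun t => norm_ne_zero_iff.2 (h t)).smul
    (contDiff_segment _ _)

/-- Extend `F` radially to the cone over its domain. The straight segment from `x` to `y` becomes a
curve from `F x` to `F y` with the same radius and the same angular speed at each time, hence the
same speed `‖y - x‖`. A chord is no longer than a curve joining its ends. -/
theorem IsLocalRiemannianIsometry.dist_le {n : ℕ} [NeZero n]
    {F : OpenPartialHomeomorph (S n) (S n)} (hF : IsLocalRiemannianIsometry F)
    {x y : S n} (hxy : (x : E n) + y ≠ 0)
    (harc : ∀ t ∈ Set.Icc (0 : ℝ) 1, arc x y hxy t ∈ F.source) :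
    dist (F x) (F y) ≤ dist x y := by
  set r : ℝ → ℝ := fun t => ‖(1 - t) • (x : E n) + t • (y : E n)‖ with hr
  have hne := segment_ne_zero (norm_eq_of_mem_sphere x) (norm_eq_of_mem_sphere y) hxy
  have key : ∀ t ∈ Set.Icc (0 : ℝ) 1, ∃ k' : E n,
      HasDerivAt (fun s => r s • (F (arc x y hxy s)).1) k' t ∧ ‖k'‖ ≤ ‖(y : E n) - x‖ := by
    intro t ht
    obtain ⟨u', v', hu, hv, huv⟩ := hF.exists_hasDerivAt
      ((contMDiff_arc x y hxy t).mdifferentiableAt (by simp)) (harc t ht)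
    have hrd : HasDerivAt r (deriv r t) t :=
      ((((contDiff_segment _ _).norm ℝ hne).differentiable (by simp)) t).hasDerivAt
    refine ⟨_, hrd.smul hu, ?_⟩
    have hγ : HasDerivAt (fun s : ℝ => (1 - s) • (x : E n) + s • (y : E n)) ((y : E n) - x) t := by
      have := (((hasDerivAt_id t).const_sub 1).smul_const (x : E n)).add
        ((hasDerivAt_id t).smul_const (y : E n))
      exact this.congr_deriv (by module)
    have hγ' : HasDerivAt (fun s : ℝ => (1 - s) • (x : E n) + s • (y : E n))
        (r t • v' + deriv r t • (arc x y hxy t : E n)) t := by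
      refine (hrd.smul hv).congr_of_eventuallyEq (Eventually.of_forall fun s => ?_)
      exact (norm_smul_arc x y hxy s).symm
    have h1 := inner_eq_zero_of_hasDerivAt hu
      (Eventually.of_forall fun s => norm_eq_of_mem_sphere _)
    have h2 := inner_eq_zero_of_hasDerivAt hv
      (Eventually.of_forall fun s => norm_eq_of_mem_sphere _)
    -- This splits the constant velocity `y - x` of the segment into its angular and radial parts.
    rw [hγ.unique hγ']
    refine le_of_eq ((sq_eq_sq₀ (norm_nonneg _) (norm_nonneg _)).1 ?_)
    rw [norm_sq_add_smul_of_orthogonal _ _ (norm_eq_of_mem_sphere _) h1,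
      norm_sq_add_smul_of_orthogonal _ _ (norm_eq_of_mem_sphere _) h2, huv]
  choose! k' hk hk' using key
  have := norm_image_sub_le_of_norm_deriv_le_segment_01'
    (fun t ht => (hk t ht).hasDerivWithinAt) (fun t ht => hk' t ⟨ht.1, ht.2.le⟩)
  simp only [hr, arc_zero, arc_one] at this
  rw [dist_comm, dist_comm x, Subtype.dist_eq, Subtype.dist_eq, dist_eq_norm, dist_eq_norm]
  simpa using this

theorem dist_sq_eq {n : ℕ} (x y : S n) :
    dist x y ^ 2 = 2 - 2 * inner ℝ (x : E n) (y : E n) := by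
  rw [Subtype.dist_eq, dist_eq_norm, norm_sub_sq_real, norm_eq_of_mem_sphere,
    norm_eq_of_mem_sphere]
  ring

theorem mem_ball_iff_inner {n : ℕ} {x y : S n} {ε : ℝ} (hε : 0 < ε) :
    x ∈ ball y ε ↔ 1 - ε ^ 2 / 2 < inner ℝ (x : E n) (y : E n) := by
  rw [mem_ball, ← sq_lt_sq₀ dist_nonneg hε.le, dist_sq_eq]
  constructor <;> intro h <;> linarith

theorem add_ne_zero_of_mem_ball {n : ℕ} {x y z : S n} {ε : ℝ} (hε : 0 < ε) (hε1 : ε ≤ 1)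
    (hx : x ∈ ball z ε) (hy : y ∈ ball z ε) : (x : E n) + y ≠ 0 := by
  rw [mem_ball_iff_inner hε] at hx hy
  intro h
  have : inner ℝ ((x : E n) + y) (z : E n) = 0 := by simp [h]
  rw [inner_add_left] at this
  nlinarith

/-- The ball is the cap where the inner product with `z` exceeds `1 - ε ^ 2 / 2`, a positive bound
as `ε ≤ 1`. The segment stays in this half-space, and dividing by its norm `r ≤ 1` only increases
the positive inner product. -/
theorem arc_mem_ball {n : ℕ} {x y z : S n} {ε : ℝ} (hε : 0 < ε) (hε1 : ε ≤ 1)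
    (hx : x ∈ ball z ε) (hy : y ∈ ball z ε) (hxy : (x : E n) + y ≠ 0) {t : ℝ}
    (ht : t ∈ Set.Icc (0 : ℝ) 1) : arc x y hxy t ∈ ball z ε := by
  rw [mem_ball_iff_inner hε] at hx hy ⊢
  set r := ‖(1 - t) • (x : E n) + t • (y : E n)‖
  have hr : r ≤ 1 := by
    refine (norm_add_le _ _).trans ?_
    rw [norm_smul, norm_smul, norm_eq_of_mem_sphere, norm_eq_of_mem_sphere, Real.norm_eq_abs,
      Real.norm_eq_abs, abs_of_nonneg ht.1, abs_of_nonneg (by linarith [ht.2])]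
    linarith
  have h0 : 0 < 1 - ε ^ 2 / 2 := by nlinarith
  have h1 : r * inner ℝ (arc x y hxy t : E n) (z : E n)
      = (1 - t) * inner ℝ (x : E n) (z : E n) + t * inner ℝ (y : E n) (z : E n) := by
    rw [← real_inner_smul_left, norm_smul_arc, inner_add_left, real_inner_smul_left,
      real_inner_smul_left]
  have h2 : 1 - ε ^ 2 / 2 < r * inner ℝ (arc x y hxy t : E n) (z : E n) := by
    rw [h1]
    exact convex_Ioi (1 - ε ^ 2 / 2) hx hy (sub_nonneg.2 ht.2) ht.1 (sub_add_cancel 1 t)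
  have hr0 : 0 ≤ r := norm_nonneg _
  nlinarith

theorem IsLocalRiemannianIsometry.exists_ball_dist_le {n : ℕ} [NeZero n]
    {F : OpenPartialHomeomorph (S n) (S n)} (hF : IsLocalRiemannianIsometry F) {z : S n}
    (hz : z ∈ F.source) :
    ∃ ε > 0, ball z ε ⊆ F.source ∧ ∀ x ∈ ball z ε, ∀ y ∈ ball z ε,
      dist (F x) (F y) ≤ dist x y := by
  obtain ⟨δ, hδ, hδs⟩ := Metric.isOpen_iff.1 F.open_source z hz
  have hε : 0 < min δ 1 := lt_min hδ one_pos
  have hsub : ball z (min δ 1) ⊆ F.source := (ball_subset_ball (min_le_left _ _)).trans hδs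
  refine ⟨min δ 1, hε, hsub, fun x hx y hy => ?_⟩
  exact hF.dist_le (add_ne_zero_of_mem_ball hε (min_le_right _ _) hx hy)
    fun t ht => hsub (arc_mem_ball hε (min_le_right _ _) hx hy _ ht)

/-- A local Riemannian isometry of the sphere preserves chordal distances near each point. -/
theorem IsLocalRiemannianIsometry.exists_ball_dist_eq {n : ℕ} [NeZero n]
    {F : OpenPartialHomeomorph (S n) (S n)} (hF : IsLocalRiemannianIsometry F) {z : S n}
    (hz : z ∈ F.source) :
    ∃ ε > 0, ∀ x ∈ ball z ε, ∀ y ∈ ball z ε, dist (F x) (F y) = dist x y := by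
  obtain ⟨ε, hε, hεs, h1⟩ := hF.exists_ball_dist_le hz
  obtain ⟨δ, hδ, -, h2⟩ := hF.symm.exists_ball_dist_le (z := F z) (F.map_source hz)
  have hm : 0 < min ε δ := lt_min hε hδ
  refine ⟨min ε δ, hm, fun x hx y hy => ?_⟩
  have hsub : ∀ w ∈ ball z (min ε δ), w ∈ ball z ε :=
    fun w hw => ball_subset_ball (min_le_left _ _) hw
  -- `F` does not increase distances to `z`, so the bound for `F.symm` near `F z` applies to the
  -- images and gives the reverse inequality.
  have hmaps : ∀ w ∈ ball z (min ε δ), F w ∈ ball (F z) δ := fun w hw =>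
    (h1 w (hsub w hw) z (mem_ball_self hε)).trans_lt (lt_of_lt_of_le hw (min_le_right _ _))
  refine le_antisymm (h1 x (hsub x hx) y (hsub y hy)) ?_
  have := h2 (F x) (hmaps x hx) (F y) (hmaps y hy)
  rwa [F.left_inv (hεs (hsub x hx)), F.left_inv (hεs (hsub y hy))] at this

/-! ### Rigidity of orthogonal maps on open subsets of the sphere -/

theorem coe_smul {n : ℕ} (A : O n) (x : S n) :
    ((A • x : S n) : E n) = Matrix.toEuclideanLin A.1 (x : E n) := rfl

/-- For small `t ≠ 0` the normalisation of `x + t • v` still lies in `W`, and `v` is a linear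
combination of it and `x`. -/
theorem span_eq_top_of_isOpen {n : ℕ} {W : Set (S n)} (hW : IsOpen W) {x : S n} (hx : x ∈ W) :
    Submodule.span ℝ ((Subtype.val : S n → E n) '' W) = ⊤ := by
  rw [eq_top_iff]
  rintro v -
  have hc : ContinuousAt (fun t : ℝ => ‖(x : E n) + t • v‖⁻¹ • ((x : E n) + t • v)) 0 := by
    have h0 : ‖(x : E n) + (0 : ℝ) • v‖ ≠ 0 := by simp [norm_eq_of_mem_sphere]
    have hl : Continuous fun t : ℝ => (x : E n) + t • v := by fun_prop
    exact (hl.norm.continuousAt.inv₀ h0).smul hl.continuousAt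
  obtain ⟨U, hU, rfl⟩ := isOpen_induced_iff.1 hW
  have hmem : ∀ᶠ t : ℝ in 𝓝 0, ‖(x : E n) + t • v‖⁻¹ • ((x : E n) + t • v) ∈ U := by
    refine hc.eventually_mem (hU.mem_nhds ?_)
    simpa [norm_eq_of_mem_sphere] using hx
  have hne : ∀ᶠ t : ℝ in 𝓝 0, (x : E n) + t • v ≠ 0 := by
    refine ContinuousAt.eventually_ne (by fun_prop) ?_
    simpa using ne_zero_of_mem_unit_sphere x
  have hall : ∀ᶠ t : ℝ in 𝓝[≠] 0, ‖(x : E n) + t • v‖⁻¹ • ((x : E n) + t • v) ∈ U ∧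
      (x : E n) + t • v ≠ 0 ∧ t ≠ 0 :=
    ((hmem.and hne).filter_mono nhdsWithin_le_nhds |>.and self_mem_nhdsWithin).mono
      fun t ht => ⟨ht.1.1, ht.1.2, ht.2⟩
  obtain ⟨t, h1, h2, h3⟩ := hall.exists
  have hnz := norm_ne_zero_iff.2 h2
  have hs1 : ‖(x : E n) + t • v‖⁻¹ • ((x : E n) + t • v) ∈
      Submodule.span ℝ ((Subtype.val : S n → E n) '' (Subtype.val ⁻¹' U)) := by
    refine Submodule.subset_span ⟨⟨_, ?_⟩, h1, rfl⟩
    rw [mem_sphere_zero_iff_norm, norm_smul, norm_inv, norm_norm, inv_mul_cancel₀ hnz]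
  have hs2 := Submodule.subset_span (R := ℝ) (Set.mem_image_of_mem (Subtype.val : S n → E n) hx)
  have hs3 := Submodule.smul_mem _ ‖(x : E n) + t • v‖ hs1
  rw [smul_inv_smul₀ hnz] at hs3
  have hs4 := Submodule.smul_mem _ t⁻¹ (Submodule.sub_mem _ hs3 hs2)
  rwa [add_sub_cancel_left, inv_smul_smul₀ h3] at hs4

theorem eq_of_eqOn_isOpen {n : ℕ} {W : Set (S n)} (hW : IsOpen W) {x : S n} (hx : x ∈ W)
    {A B : O n} (h : ∀ y ∈ W, A • y = B • y) : A = B := by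
  apply Subtype.ext
  apply (Matrix.toEuclideanLin (𝕜 := ℝ)).injective
  refine LinearMap.ext_on (span_eq_top_of_isOpen hW hx) ?_
  rintro _ ⟨y, hy, rfl⟩
  exact congrArg Subtype.val (h y hy)

theorem continuous_smul_sphere {n : ℕ} (A : O n) : Continuous fun x : S n => A • x :=
  Continuous.subtype_mk
    ((LinearMap.continuous_of_finiteDimensional (Matrix.toEuclideanLin A.1)).comp
      continuous_subtype_val) _

/-- If `A` and `B` agree pointwise up to a finite group on an open set, they agree up to one
element of the group. -/
theorem exists_eq_mul_of_isOpen {n : ℕ} {H : Subgroup (O n)} [Finite H] {W : Set (S n)}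
    (hW : IsOpen W) {x : S n} (hx : x ∈ W) {A B : O n}
    (h : ∀ y ∈ W, ∃ g ∈ H, A • y = g • B • y) : ∃ g ∈ H, A = g * B := by
  -- The index `none` carries the complement of `W`, so that these finitely many closed sets cover
  -- the sphere. By Baire one of their interiors meets `W`, and it cannot be that of `none`.
  let K : Option H → Set (S n) := fun o => o.elim Wᶜ fun g => {y | A • y = (g.1 * B) • y}
  have hK : ∀ o, IsClosed (K o) := by
    rintro (_ | g)
    · exact hW.isClosed_compl
    · exact isClosed_eq (continuous_smul_sphere _) (continuous_smul_sphere _)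
  have hU : ⋃ o, K o = Set.univ := by
    refine Set.eq_univ_of_forall fun y => Set.mem_iUnion.2 ?_
    by_cases hy : y ∈ W
    · obtain ⟨g, hg, hgy⟩ := h y hy
      exact ⟨some ⟨g, hg⟩, by simpa [K, mul_smul] using hgy⟩
    · exact ⟨none, hy⟩
  have : Countable (Option H) := Finite.to_countable
  obtain ⟨y, hyW, hy⟩ := (dense_iUnion_interior_of_closed hK hU).inter_open_nonempty W hW ⟨x, hx⟩
  obtain ⟨o, ho⟩ := Set.mem_iUnion.1 hy
  cases o with
  | none => exact absurd hyW (interior_subset ho)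
  | some g =>
    refine ⟨g.1, g.2, eq_of_eqOn_isOpen isOpen_interior ho fun z hz => ?_⟩
    exact interior_subset (s := K (some g)) hz

theorem exists_orthogonal_of_inner_eq {n : ℕ} {L : E n →ₗ[ℝ] E n}
    (hL : ∀ u v, inner ℝ (L u) (L v) = inner ℝ u v) :
    ∃ A : O n, Matrix.toEuclideanLin A.1 = L := by
  obtain ⟨M, rfl⟩ := (Matrix.toEuclideanLin (𝕜 := ℝ)).surjective L
  refine ⟨⟨M, ?_⟩, rfl⟩
  rw [Matrix.mem_orthogonalGroup_iff']
  ext i j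
  have hcol : ∀ i k, Matrix.toEuclideanLin M (EuclideanSpace.single i (1 : ℝ)) k = M k i := by
    simp [Matrix.toLpLin_apply]
  have h := hL (EuclideanSpace.single i 1) (EuclideanSpace.single j 1)
  rw [PiLp.inner_apply, EuclideanSpace.inner_single_left] at h
  simp only [hcol, RCLike.inner_apply, conj_trivial] at h
  rw [Matrix.mul_apply, Matrix.one_apply]
  simpa [mul_comm, Pi.single_apply] using h

/-- A map of the sphere preserving distances near a point is the restriction of an orthogonal
transformation there. -/
theorem exists_orthogonal_of_dist_eq {n : ℕ} {f : S n → S n} {W : Set (S n)} (hW : IsOpen W)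
    {x : S n} (hx : x ∈ W) (h : ∀ y ∈ W, ∀ z ∈ W, dist (f y) (f z) = dist y z) :
    ∃ A : O n, ∀ y ∈ W, f y = A • y := by
  have hin : ∀ y ∈ W, ∀ z ∈ W,
      inner ℝ (f y : E n) (f z : E n) = inner ℝ (y : E n) (z : E n) := by
    intro y hy z hz
    have h1 := dist_sq_eq (f y) (f z)
    rw [h y hy z hz, dist_sq_eq] at h1
    linarith
  have hspan := span_eq_top_of_isOpen hW hx
  -- A basis consisting of points of `W`: `f` on it defines the linear map `L`, which preserves
  -- inner products because `f` does.
  let b := Module.Basis.ofSpan hspan.ge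
  have hb : ∀ i, ∃ y ∈ W, (y : E n) = b i := fun i =>
    Module.Basis.ofSpan_subset hspan.ge ⟨i, rfl⟩
  choose w hwW hw using hb
  let L : E n →ₗ[ℝ] E n := b.constr ℝ fun i => (f (w i) : E n)
  have hLb : ∀ i, L (b i) = f (w i) := fun i => b.constr_basis ℝ _ i
  have hL : ∀ u v, inner ℝ (L u) (L v) = inner ℝ u v := by
    have : (innerₗ (E n)).compl₁₂ L L = innerₗ (E n) := by
      refine LinearMap.ext_basis b b fun i j => ?_
      simp only [LinearMap.compl₁₂_apply, innerₗ_apply_apply, hLb, hin _ (hwW i) _ (hwW j), hw]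
    exact fun u v => congrArg (fun B => B u v) this
  let I : E n →ₗᵢ[ℝ] E n := L.isometryOfInner hL
  have hsurj : Function.Surjective L :=
    LinearMap.surjective_of_injective (f := L) I.injective
  have hf : ∀ y ∈ W, (f y : E n) = L y := by
    intro y hy
    -- The difference `f y - L y` is orthogonal to the range of `L`, which is the whole space, so it
    -- vanishes.
    have h0 : ∀ v, inner ℝ (L v) ((f y : E n) - L y) = 0 := by
      have : (innerₗ (E n)).flip ((f y : E n) - L y) ∘ₗ L = 0 := by
        refine b.ext fun i => ?_
        simp only [LinearMap.comp_apply, LinearMap.flip_apply, innerₗ_apply_apply,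
          LinearMap.zero_apply, inner_sub_right]
        rw [hL, hLb, hin _ (hwW i) _ hy, hw, sub_self]
      exact fun v => congrArg (fun B => B v) this
    obtain ⟨v, hv⟩ := hsurj ((f y : E n) - L y)
    have := h0 v
    rw [hv, inner_self_eq_zero] at this
    exact sub_eq_zero.1 this
  obtain ⟨A, hA⟩ := exists_orthogonal_of_inner_eq hL
  refine ⟨A, fun y hy => Subtype.ext ?_⟩
  rw [coe_smul, hf y hy, hA]

/-! ### Lifting orbifold isometries; conjugacy of the groups -/

theorem proj_eq_iff {n : ℕ} {H : Subgroup (O n)} {x y : S n} :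
    proj H x = proj H y ↔ ∃ g ∈ H, x = g • y := by
  refine Quotient.eq.trans ?_
  rw [MulAction.orbitRel_apply, MulAction.mem_orbit_iff]
  constructor
  · rintro ⟨g, hg⟩
    exact ⟨g.1, g.2, hg.symm⟩
  · rintro ⟨g, hg, h⟩
    exact ⟨⟨g, hg⟩, h.symm⟩

theorem proj_smul {n : ℕ} {H : Subgroup (O n)} {g : O n} (hg : g ∈ H) (x : S n) :
    proj H (g • x) = proj H x :=
  proj_eq_iff.2 ⟨g, hg, rfl⟩

theorem OrbifoldIsometry.exists_local_orthogonal {n : ℕ} [NeZero n] {G G' : Subgroup (O n)}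
    (φ : OrbifoldIsometry G G') (x : S n) :
    ∃ A : O n, ∀ᶠ y in 𝓝 x, proj G' (A • y) = φ.toHomeomorph (proj G y) := by
  obtain ⟨F, hx, hF, hφ⟩ := φ.exists_lift x
  obtain ⟨ε, hε, hd⟩ := hF.exists_ball_dist_eq hx
  obtain ⟨A, hA⟩ := exists_orthogonal_of_dist_eq isOpen_ball (mem_ball_self hε) hd
  refine ⟨A, ?_⟩
  filter_upwards [ball_mem_nhds x hε, F.open_source.mem_nhds hx] with y hy hys
  rw [← hA y hy, hφ y hys]

instance preconnectedSpace_sphere (n : ℕ) [NeZero n] : PreconnectedSpace (S n) := by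
  refine isPreconnected_iff_preconnectedSpace.1 (isPreconnected_sphere ?_ _ _)
  rw [← Module.finrank_eq_rank]
  have := NeZero.pos n
  simp only [finrank_euclideanSpace, Fintype.card_prod, Fintype.card_fin]
  norm_cast
  omega

theorem sphere_nonempty (n : ℕ) [NeZero n] : Nonempty (S n) :=
  ⟨⟨EuclideanSpace.single (0, 0) 1, by simp⟩⟩

/-- An isometry of quotients of the sphere by finite groups lifts to an orthogonal map. -/
theorem OrbifoldIsometry.exists_orthogonal {n : ℕ} [NeZero n] {G G' : Subgroup (O n)} [Finite G']
    (φ : OrbifoldIsometry G G') :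
    ∃ A : O n, ∀ y, proj G' (A • y) = φ.toHomeomorph (proj G y) := by
  obtain ⟨x⟩ := sphere_nonempty n
  obtain ⟨A, hA⟩ := φ.exists_local_orthogonal x
  refine ⟨A, ?_⟩
  -- `T` is shown to be clopen. At a point of its closure another local lift `B` exists; it meets
  -- `T` in an open set, where `A = g * B` with `g ∈ G'`, so `A` is a lift wherever `B` is.
  set T := interior {y | proj G' (A • y) = φ.toHomeomorph (proj G y)} with hT
  have hclosed : IsClosed T := by
    refine isClosed_of_closure_subset fun y hy => ?_
    obtain ⟨B, hB⟩ := φ.exists_local_orthogonal y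
    obtain ⟨V, hVB, hV, hyV⟩ := _root_.eventually_nhds_iff.1 hB
    obtain ⟨z, hzV, hzT⟩ := mem_closure_iff.1 hy V hV hyV
    obtain ⟨g, hg, hAB⟩ := exists_eq_mul_of_isOpen (H := G') (A := A) (B := B)
      (hV.inter isOpen_interior) ⟨hzV, hzT⟩ fun w hw => by
        have h1 : proj G' (A • w) = φ.toHomeomorph (proj G w) :=
            interior_subset (s := {y | proj G' (A • y) = φ.toHomeomorph (proj G y)}) hw.2
        rw [← hVB w hw.1] at h1
        exact proj_eq_iff.1 h1
    refine mem_interior_iff_mem_nhds.2 (mem_of_superset (hV.mem_nhds hyV) fun w hw => ?_)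
    change proj G' (A • w) = φ.toHomeomorph (proj G w)
    rw [hAB, mul_smul, proj_smul hg, hVB w hw]
  have huniv : T = Set.univ :=
    IsClopen.eq_univ ⟨hclosed, isOpen_interior⟩ ⟨x, mem_interior_iff_mem_nhds.2 hA⟩
  intro y
  have hy : y ∈ T := huniv ▸ Set.mem_univ y
  exact interior_subset (s := {y | proj G' (A • y) = φ.toHomeomorph (proj G y)}) hy

/-- Isometric quotients of the sphere have conjugate groups. -/
theorem OrbifoldIsometry.exists_conj {n : ℕ} [NeZero n] {G G' : Subgroup (O n)} [Finite G]
    [Finite G'] (φ : OrbifoldIsometry G G') :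
    ∃ A : O n, (∀ g ∈ G, A * g * A⁻¹ ∈ G') ∧ ∀ g ∈ G', A⁻¹ * g * A ∈ G := by
  obtain ⟨A, hA⟩ := φ.exists_orthogonal
  obtain ⟨x⟩ := sphere_nonempty n
  refine ⟨A, fun g hg => ?_, fun g hg => ?_⟩
  -- `A * g` and `A` lift the same map to the quotient by `G'`.
  · obtain ⟨g', hg', h⟩ := exists_eq_mul_of_isOpen (H := G') (A := A * g) (B := A) isOpen_univ
      (Set.mem_univ x) fun y _ => by
        rw [← proj_eq_iff, mul_smul, hA, hA, proj_smul hg]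
    rwa [h, mul_inv_cancel_right]
  -- By injectivity of the isometry, `A⁻¹ * g * A` induces the identity on the quotient by `G`.
  · obtain ⟨g', hg', h⟩ := exists_eq_mul_of_isOpen (H := G) (A := A⁻¹ * g * A) (B := 1) isOpen_univ
      (Set.mem_univ x) fun y _ => by
        rw [← proj_eq_iff, one_smul]
        apply φ.toHomeomorph.injective
        rw [← hA, ← hA, ← mul_smul, mul_assoc, mul_inv_cancel_left, mul_smul, proj_smul hg]
    rwa [h, mul_one]

/-! ### Arithmetic of the generators modulo `q` -/

theorem R_add (a b : ℝ) : R (a + b) = R a * R b := by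
  simp only [R, mul_add, Real.cos_add, Real.sin_add, Matrix.mul_fin_two]
  congr! 3 <;> ring_nf

theorem R_intCast (m : ℤ) : R m = 1 := by
  have h1 : Real.cos (2 * Real.pi * m) = 1 :=
    (Real.cos_eq_one_iff _).2 ⟨m, mul_comm _ _⟩
  have h2 : Real.sin (2 * Real.pi * m) = 0 := by
    have := Real.sin_sq_add_cos_sq (2 * Real.pi * m)
    rw [h1] at this
    exact pow_eq_zero_iff two_ne_zero |>.1 (by linarith)
  rw [R, h1, h2, neg_zero, Matrix.one_fin_two]

theorem coe_generator {n : ℕ} (q : ℕ) (p : Fin n → ℤ) :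
    (generator q p).1 = Matrix.blockDiagonal fun i => R ((p i : ℝ) / (q : ℝ)) := rfl

theorem generator_eq_one {n q : ℕ} {p : Fin n → ℤ} (h : ∀ i, R ((p i : ℝ) / (q : ℝ)) = 1) :
    generator q p = 1 := by
  apply Subtype.ext
  rw [coe_generator]
  simp only [h]
  exact Matrix.blockDiagonal_one

theorem generator_add {n : ℕ} (q : ℕ) (p s : Fin n → ℤ) :
    generator q (p + s) = generator q p * generator q s := by
  apply Subtype.ext
  change (generator q (p + s)).1 = (generator q p).1 * (generator q s).1
  rw [coe_generator, coe_generator, coe_generator, ← Matrix.blockDiagonal_mul]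
  congr 1
  ext1 i
  rw [← R_add, Pi.add_apply, Int.cast_add, add_div]

/-- `generator q` as a homomorphism. -/
def generatorHom (n q : ℕ) : Multiplicative (Fin n → ℤ) →* O n where
  toFun p := generator q p.toAdd
  map_one' := generator_eq_one fun i => by simpa using R_intCast 0
  map_mul' p s := generator_add q p.toAdd s.toAdd

theorem generator_zsmul {n : ℕ} (q : ℕ) (l : ℤ) (p : Fin n → ℤ) :
    generator q (l • p) = generator q p ^ l :=
  map_zpow (generatorHom n q) (Multiplicative.ofAdd p) l

theorem generator_eq_one_iff {n q : ℕ} (hq : 0 < q) (p : Fin n → ℤ) :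
    generator q p = 1 ↔ ∀ i, (q : ℤ) ∣ p i := by
  have hq' : (q : ℝ) ≠ 0 := by positivity
  constructor
  · intro h i
    have h1 : (generator q p).1 (0, i) (0, i) = 1 := by
      rw [h]
      exact Matrix.one_apply_eq _
    rw [coe_generator, Matrix.blockDiagonal_apply_eq] at h1
    obtain ⟨m, hm⟩ := (Real.cos_eq_one_iff _).1 h1
    refine ⟨m, ?_⟩
    have h2 : (m : ℝ) = p i / q :=
      mul_right_cancel₀ Real.two_pi_pos.ne' (hm.trans (mul_comm _ _))
    rw [eq_div_iff hq'] at h2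
    rw [mul_comm]
    exact_mod_cast h2.symm
  · intro h
    refine generator_eq_one fun i => ?_
    obtain ⟨m, hm⟩ := h i
    rw [hm, Int.cast_mul, Int.cast_natCast, mul_div_cancel_left₀ _ hq', R_intCast]

theorem generator_eq_iff {n q : ℕ} (hq : 0 < q) (p s : Fin n → ℤ) :
    generator q p = generator q s ↔ ∀ i, p i ≡ s i [ZMOD q] := by
  have h : generator q p = generator q (p - s) * generator q s := by
    rw [← generator_add, sub_add_cancel]
  rw [h, mul_eq_right, generator_eq_one_iff hq]
  exact forall_congr' fun i => (Int.modEq_iff_dvd.symm.trans Int.modEq_comm)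

theorem finite_group {n q : ℕ} (hq : 0 < q) (p : Fin n → ℤ) : Finite (group q p) := by
  refine isOfFinOrder_iff_zpow_eq_one.2 ⟨q, by exact_mod_cast hq.ne', ?_⟩ |>.finite_zpowers
  rw [← generator_zsmul, generator_eq_one_iff hq]
  exact fun i => ⟨p i, by simp⟩

/-- The exponents by which a power of the generator still generates are coprime to `q`. -/
theorem isCoprime_of_zpow_zpow_eq {n q : ℕ} (hq : 0 < q) {s : Fin n → ℤ}
    (hs : Int.gcd (Finset.univ.gcd s) q = 1) {l m : ℤ}
    (h : (generator q s ^ l) ^ m = generator q s) : IsCoprime l (q : ℤ) := by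
  have h1 : generator q ((l * m - 1) • s) = 1 := by
    rw [generator_zsmul, zpow_sub, zpow_mul, h, zpow_one, mul_inv_cancel]
  rw [generator_eq_one_iff hq] at h1
  -- `q` divides every `(l * m - 1) * s i`, hence their gcd; as the gcd of the `s i` is coprime to
  -- `q`, it can be cancelled.
  have h2 : (q : ℤ) ∣ (l * m - 1) * Finset.univ.gcd s := by
    have : (q : ℤ) ∣ Finset.univ.gcd fun i => (l * m - 1) * s i :=
      Finset.dvd_gcd fun i _ => by simpa using h1 i
    rw [Finset.gcd_mul_left] at this
    exact this.trans (mul_dvd_mul_right (normalize_associated _).dvd _)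
  have h3 : IsCoprime (q : ℤ) (Finset.univ.gcd s) := (Int.isCoprime_iff_gcd_eq_one.2 hs).symm
  obtain ⟨k, hk⟩ := h3.dvd_of_dvd_mul_right h2
  exact ⟨m, -k, by linear_combination hk⟩

/-! ### Rotation angles as conjugation invariants -/

/-- Adding the transpose cancels the sines. Orthogonal conjugation commutes with transposition, so
the resulting real diagonal matrices can be compared without complex eigenvalues. -/
theorem generator_add_transpose {n : ℕ} (q : ℕ) (p : Fin n → ℤ) :
    (generator q p).1 + (generator q p).1.transpose =
      Matrix.diagonal fun k : Fin 2 × Fin n =>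
        2 * Real.cos (2 * Real.pi * ((p k.2 : ℝ) / (q : ℝ))) := by
  rw [coe_generator, Matrix.blockDiagonal_transpose, ← Matrix.blockDiagonal_add,
    ← Matrix.blockDiagonal_diagonal fun i (_ : Fin 2) =>
      2 * Real.cos (2 * Real.pi * ((p i : ℝ) / (q : ℝ)))]
  congr 1
  ext i a b
  fin_cases a <;> fin_cases b <;> simp [R] <;> ring

/-- The multiplicity of a root is twice the number of indices with that value, so `c` and `d` have
fibres of equal size, and bijections between the fibres glue to a permutation. -/
theorem exists_perm_of_charpoly_eq {n : ℕ} {c d : Fin n → ℝ}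
    (h : (Matrix.diagonal fun k : Fin 2 × Fin n => c k.2).charpoly =
      (Matrix.diagonal fun k : Fin 2 × Fin n => d k.2).charpoly) :
    ∃ σ : Equiv.Perm (Fin n), ∀ i, c i = d (σ i) := by
  classical
  have hcount : ∀ (f : Fin n → ℝ) (x : ℝ),
      (Matrix.diagonal fun k : Fin 2 × Fin n => f k.2).charpoly.roots.count x =
        2 * Fintype.card {i // f i = x} := by
    intro f x
    rw [Matrix.charpoly_diagonal]
    have : (∏ k : Fin 2 × Fin n, (Polynomial.X - Polynomial.C (f k.2))).roots =
        Finset.univ.val.map fun k : Fin 2 × Fin n => f k.2 :=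
      Polynomial.roots_multiset_prod_X_sub_C
        (Finset.univ.val.map fun k : Fin 2 × Fin n => f k.2) ▸ by
          rw [Multiset.map_map]; rfl
    rw [this, Multiset.count_map]
    let e : {k : Fin 2 × Fin n // x = f k.2} ≃ Fin 2 × {i // f i = x} :=
      { toFun := fun k => (k.1.1, ⟨k.1.2, k.2.symm⟩)
        invFun := fun k => ⟨(k.1, k.2.1), k.2.2.symm⟩
        left_inv := fun _ => rfl
        right_inv := fun _ => rfl }
    have h2 := Fintype.card_congr e
    rw [Fintype.card_prod, Fintype.card_fin, Fintype.card_subtype] at h2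
    exact h2
  have hcard : ∀ x, Fintype.card {i // c i = x} = Fintype.card {i // d i = x} := by
    intro x
    have h1 := hcount c x
    rw [h, hcount d x] at h1
    omega
  refine ⟨Equiv.ofFiberEquiv (f := c) (g := d) fun x => Fintype.equivOfCardEq (hcard x),
    fun i => ?_⟩
  exact (Equiv.ofFiberEquiv_map _ i).symm

theorem exists_unit_modEq_of_cos_eq {q : ℕ} (hq : 0 < q) {a b : ℤ}
    (h : Real.cos (2 * Real.pi * ((a : ℝ) / (q : ℝ))) =
      Real.cos (2 * Real.pi * ((b : ℝ) / (q : ℝ)))) :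
    ∃ e : ℤˣ, a ≡ e * b [ZMOD q] := by
  have hq' : (q : ℝ) ≠ 0 := by positivity
  obtain ⟨k, hk | hk⟩ := Real.cos_eq_cos_iff.1 h
  · refine ⟨1, Int.modEq_iff_dvd.2 ⟨k, ?_⟩⟩
    field_simp at hk
    have : b = q * k + a := by exact_mod_cast hk
    simp [this]
  · refine ⟨-1, Int.modEq_iff_dvd.2 ⟨-k, ?_⟩⟩
    field_simp at hk
    have : b = q * k - a := by exact_mod_cast hk
    simp [this]

/-- Conjugate block rotations have the same angles up to order and sign. -/
theorem exists_perm_of_conj_eq {n q : ℕ} (hq : 0 < q) {p s : Fin n → ℤ} {A : O n}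
    (h : A * generator q p * A⁻¹ = generator q s) :
    ∃ (e : Fin n → ℤˣ) (σ : Equiv.Perm (Fin n)),
      ∀ i, p i ≡ (e (σ i) : ℤ) * s (σ i) [ZMOD q] := by
  have hA : A.1.transpose * A.1 = 1 := (Matrix.mem_orthogonalGroup_iff' _ _).1 A.2
  have h1 : A.1 * (generator q p).1 * A.1.transpose = (generator q s).1 :=
    congrArg Subtype.val h
  have h2 := congrArg Matrix.transpose h1
  rw [Matrix.transpose_mul, Matrix.transpose_mul, Matrix.transpose_transpose,
    ← Matrix.mul_assoc] at h2
  have h3 : A.1 * ((generator q p).1 + (generator q p).1.transpose) * A.1.transpose =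
      (generator q s).1 + (generator q s).1.transpose := by
    rw [Matrix.mul_add, Matrix.add_mul, h1, h2]
  rw [generator_add_transpose, generator_add_transpose] at h3
  have h4 := congrArg Matrix.charpoly h3
  rw [Matrix.charpoly_mul_comm, ← Matrix.mul_assoc, hA, Matrix.one_mul] at h4
  obtain ⟨σ, hσ⟩ := exists_perm_of_charpoly_eq
    (c := fun i => 2 * Real.cos (2 * Real.pi * ((p i : ℝ) / (q : ℝ))))
    (d := fun i => 2 * Real.cos (2 * Real.pi * ((s i : ℝ) / (q : ℝ)))) h4
  -- The signs are indexed by the entries of `s`, whence the passage through `σ.symm`.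
  have h5 : ∀ i, ∃ e : ℤˣ, p (σ.symm i) ≡ e * s i [ZMOD q] := fun i =>
    exists_unit_modEq_of_cos_eq hq <| mul_left_cancel₀ two_ne_zero <| by
      simpa using hσ (σ.symm i)
  choose e he using h5
  exact ⟨e, σ, fun i => by simpa using he (σ i)⟩

/-! ### Conjugate groups give isometric quotients -/

theorem contMDiff_smul_sphere {n : ℕ} [NeZero n] (A : O n) :
    ContMDiff (𝓡 (2 * n - 1)) (𝓡 (2 * n - 1)) ∞ fun x : S n => A • x := by
  refine ContMDiff.codRestrict_sphere (n := 2 * n - 1)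
    (f := fun x : S n => Matrix.toEuclideanLin A.1 (x : E n)) ?_ (fun x => (A • x).2)
  have hL : ContDiff ℝ ∞ (LinearMap.toContinuousLinearMap (Matrix.toEuclideanLin A.1)) :=
    ContinuousLinearMap.contDiff _
  exact hL.contMDiff.comp contMDiff_coe_sphere

/-- The homeomorphism of the sphere defined by an orthogonal transformation. -/
def smulHomeomorph {n : ℕ} (A : O n) : S n ≃ₜ S n where
  toEquiv := MulAction.toPerm A
  continuous_toFun := continuous_smul_sphere A
  continuous_invFun := continuous_smul_sphere A⁻¹

/-- The inclusion in Euclidean space intertwines the action with a linear map. Differentiating this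
identity reduces the claim to that linear map preserving inner products. -/
theorem isLocalRiemannianIsometry_smul {n : ℕ} [NeZero n] (A : O n) :
    IsLocalRiemannianIsometry (smulHomeomorph A).toOpenPartialHomeomorph where
  contMDiffOn := (contMDiff_smul_sphere A).contMDiffOn
  contMDiffOn_symm := (contMDiff_smul_sphere A⁻¹).contMDiffOn
  metric_eq := by
    intro y _ v w
    have hs : MDifferentiableAt (𝓡 (2 * n - 1)) (𝓡 (2 * n - 1)) (fun x : S n => A • x) y :=
      (contMDiff_smul_sphere A y).mdifferentiableAt (by simp)
    have h1 := (mdifferentiableAt_val (A • y)).hasMFDerivAt.comp y hs.hasMFDerivAt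
    let L : E n →L[ℝ] E n := LinearMap.toContinuousLinearMap (Matrix.toEuclideanLin A.1)
    have hL : HasMFDerivAt 𝓘(ℝ, E n) 𝓘(ℝ, E n) L (y : E n) L :=
      L.hasFDerivAt.hasMFDerivAt
    have h2 := hL.comp y (mdifferentiableAt_val y).hasMFDerivAt
    have heq := hasMFDerivAt_unique h1 h2
    have happ : ∀ v : TangentSpace (𝓡 (2 * n - 1)) y,
        mfderiv (𝓡 (2 * n - 1)) 𝓘(ℝ, E n) (Subtype.val : S n → E n) (A • y)
          (mfderiv (𝓡 (2 * n - 1)) (𝓡 (2 * n - 1)) (fun x : S n => A • x) y v) =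
        L (mfderiv (𝓡 (2 * n - 1)) 𝓘(ℝ, E n) (Subtype.val : S n → E n) y v) :=
      fun v => congrArg (fun M => M v) heq
    let I : E n →ₗᵢ[ℝ] E n := ⟨Matrix.toEuclideanLin A.1, norm_toEuclideanLin A⟩
    unfold roundMetric
    have := I.inner_map_map (mfderiv (𝓡 (2 * n - 1)) 𝓘(ℝ, E n) (Subtype.val : S n → E n) y v)
      (mfderiv (𝓡 (2 * n - 1)) 𝓘(ℝ, E n) (Subtype.val : S n → E n) y w)
    refine Eq.trans ?_ this
    exact congrArg₂ (inner ℝ) (happ v) (happ w)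

theorem proj_smul_eq_of_conj {n : ℕ} {G G' : Subgroup (O n)} {A : O n}
    (h : ∀ g ∈ G, A * g * A⁻¹ ∈ G') {x y : S n} (hxy : proj G x = proj G y) :
    proj G' (A • x) = proj G' (A • y) := by
  obtain ⟨g, hg, rfl⟩ := proj_eq_iff.1 hxy
  refine proj_eq_iff.2 ⟨_, h g hg, ?_⟩
  rw [← mul_smul, ← mul_smul, inv_mul_cancel_right]

/-- The map between quotients of the sphere induced by an orthogonal transformation. -/
def quotientMap {n : ℕ} {G G' : Subgroup (O n)} (A : O n) (h : ∀ g ∈ G, A * g * A⁻¹ ∈ G') :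
    SphereQuotient G → SphereQuotient G' :=
  Quotient.lift (fun x => proj G' (A • x)) fun _ _ hxy =>
    proj_smul_eq_of_conj h (Quotient.sound hxy)

theorem continuous_proj {n : ℕ} (G : Subgroup (O n)) : Continuous (proj G) :=
  continuous_quotient_mk'

theorem continuous_quotientMap {n : ℕ} {G G' : Subgroup (O n)} (A : O n)
    (h : ∀ g ∈ G, A * g * A⁻¹ ∈ G') : Continuous (quotientMap A h) :=
  ((continuous_proj G').comp (continuous_smul_sphere A)).quotient_lift _

/-- Quotients of the sphere by conjugate groups are isometric. -/
def orbifoldIsometryOfConj {n : ℕ} [NeZero n] {G G' : Subgroup (O n)} (A : O n)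
    (h : ∀ g ∈ G, A * g * A⁻¹ ∈ G') (h' : ∀ g ∈ G', A⁻¹ * g * A ∈ G) : OrbifoldIsometry G G' where
  toHomeomorph :=
    { toFun := quotientMap A h
      invFun := quotientMap A⁻¹ (by simpa using h')
      left_inv := Quotient.ind fun x => congrArg (proj G) (inv_smul_smul A x)
      right_inv := Quotient.ind fun x => congrArg (proj G') (smul_inv_smul A x)
      continuous_toFun := continuous_quotientMap A h
      continuous_invFun := continuous_quotientMap A⁻¹ _ }
  exists_lift _ := ⟨(smulHomeomorph A).toOpenPartialHomeomorph, Set.mem_univ _,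
    isLocalRiemannianIsometry_smul A, fun _ _ => rfl⟩

/-! ### Signed permutations of the coordinate planes -/

/-- The reflection of the plane in the first axis if `e = -1`, the identity if `e = 1`. -/
def signMatrix (e : ℤˣ) : Matrix (Fin 2) (Fin 2) ℝ :=
  !![1, 0; 0, ((e : ℤ) : ℝ)]

theorem signMatrix_mul_transpose (e : ℤˣ) : signMatrix e * (signMatrix e).transpose = 1 := by
  ext i j
  rcases Int.units_eq_one_or e with rfl | rfl <;> fin_cases i <;> fin_cases j <;>
    simp [signMatrix, Matrix.mul_apply]

theorem signMatrix_mul_R (e : ℤˣ) (θ : ℝ) :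
    signMatrix e * R (((e : ℤ) : ℝ) * θ) = R θ * signMatrix e := by
  ext i j
  rcases Int.units_eq_one_or e with rfl | rfl <;> fin_cases i <;> fin_cases j <;>
    simp [signMatrix, R, Matrix.mul_apply]

/-- The orthogonal map that permutes the coordinate planes by `σ` and then reflects those where
`e = -1`. -/
def signedPerm {n : ℕ} (e : Fin n → ℤˣ) (σ : Equiv.Perm (Fin n)) : O n :=
  ⟨(Matrix.blockDiagonal fun i => signMatrix (e i)).submatrix id
      (Equiv.prodCongr (Equiv.refl (Fin 2)) σ), by
    rw [Matrix.mem_orthogonalGroup_iff, Matrix.transpose_submatrix, Matrix.submatrix_mul_equiv,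
      Matrix.blockDiagonal_transpose, ← Matrix.blockDiagonal_mul]
    simp only [signMatrix_mul_transpose]
    rw [Matrix.submatrix_id_id]
    exact Matrix.blockDiagonal_one⟩

/-- Permuting the planes reorders the rotation blocks, and a reflection of a plane reverses its
rotation, which absorbs the sign. -/
theorem signedPerm_mul_generator {n : ℕ} (q : ℕ) (e : Fin n → ℤˣ) (σ : Equiv.Perm (Fin n))
    (s : Fin n → ℤ) :
    signedPerm e σ * generator q (fun i => (e (σ i) : ℤ) * s (σ i)) =
      generator q s * signedPerm e σ := by
  apply Subtype.ext
  let τ := Equiv.prodCongr (Equiv.refl (Fin 2)) σ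
  have h : (generator q (fun i => (e (σ i) : ℤ) * s (σ i))).1 =
      (Matrix.blockDiagonal fun i => R (((e i : ℤ) : ℝ) * ((s i : ℝ) / (q : ℝ)))).submatrix
        τ τ := by
    ext ⟨a, i⟩ ⟨b, j⟩
    simp [generator, τ, Matrix.blockDiagonal_apply, mul_div_assoc]
  change (Matrix.blockDiagonal fun i => signMatrix (e i)).submatrix id τ * Subtype.val _ =
    (Matrix.blockDiagonal fun i => R ((s i : ℝ) / (q : ℝ))) *
      (Matrix.blockDiagonal fun i => signMatrix (e i)).submatrix id τ
  rw [h, Matrix.submatrix_mul_equiv, ← Matrix.blockDiagonal_mul]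
  simp only [signMatrix_mul_R]
  rw [Matrix.blockDiagonal_mul, ← Matrix.submatrix_id_id
    (Matrix.blockDiagonal fun i => R ((s i : ℝ) / (q : ℝ)))]
  exact (Matrix.submatrix_mul_equiv _ _ id (Equiv.refl _) τ).symm

end LensSpace

end

theorem proposition2p2p1 (n : ℕ) [NeZero n] (q : ℕ) (hq : 0 < q) (p s : Fin n → ℤ)
    (hp : Int.gcd (Finset.univ.gcd p) q = 1) (hs : Int.gcd (Finset.univ.gcd s) q = 1) :
    LensSpace.Isometric q p s ↔
      ∃ l : ℤ, IsCoprime l (q : ℤ) ∧ ∃ e : Fin n → ℤˣ, ∃ σ : Equiv.Perm (Fin n),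
        ∀ i, p i ≡ (e (σ i) : ℤ) * l * s (σ i) [ZMOD q] := by
  open LensSpace in
  constructor
  · rintro ⟨φ⟩
    have := finite_group hq p
    have := finite_group hq s
    obtain ⟨A, h1, h2⟩ := φ.exists_conj
    obtain ⟨l, hl⟩ := Subgroup.mem_zpowers_iff.1 (h1 _ (Subgroup.mem_zpowers _))
    obtain ⟨m, hm⟩ := Subgroup.mem_zpowers_iff.1 (h2 _ (Subgroup.mem_zpowers _))
    have hlm : (generator q s ^ l) ^ m = generator q s := by
      rw [hl, conj_zpow, hm]
      group
    -- The `l`-th power of the generator for `s` is the generator for `l • s`, so the angles of two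
    -- block rotations are compared.
    obtain ⟨e, σ, h⟩ := exists_perm_of_conj_eq hq (hl.symm.trans (generator_zsmul q l s).symm)
    refine ⟨l, isCoprime_of_zpow_zpow_eq hq hs hlm, e, σ, fun i => ?_⟩
    simpa [mul_assoc] using h i
  · rintro ⟨l, ⟨m, k, hmk⟩, e, σ, h⟩
    have hgen : generator q p = generator q fun i => (e (σ i) : ℤ) * (l • s) (σ i) :=
      (generator_eq_iff hq _ _).2 fun i => by simpa [mul_assoc] using h i
    have hconj : signedPerm e σ * generator q p * (signedPerm e σ)⁻¹ = generator q s ^ l := by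
      rw [hgen, signedPerm_mul_generator, mul_inv_cancel_right, generator_zsmul]
    -- Bézout's identity makes `m` inverse to `l` modulo `q`, and a generator depends only on its
    -- parameters modulo `q`.
    have hpow : (generator q s ^ l) ^ m = generator q s := by
      rw [← zpow_mul, ← generator_zsmul, generator_eq_iff hq]
      refine fun i => Int.modEq_iff_dvd.2 ⟨k * s i, ?_⟩
      simp only [Pi.smul_apply, smul_eq_mul]
      linear_combination (-s i) * hmk
    refine ⟨orbifoldIsometryOfConj (signedPerm e σ) ?_ ?_⟩
    · rintro _ ⟨a, rfl⟩
      refine ⟨l * a, ?_⟩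
      change generator q s ^ (l * a) = _ * generator q p ^ a * _
      rw [zpow_mul, ← hconj, conj_zpow]
    · rintro _ ⟨a, rfl⟩
      -- The generator for `s` is the `m`-th power of the conjugated generator for `p`, so
      -- conjugating its `a`-th power back gives the exponent `m * a`.
      refine ⟨m * a, ?_⟩
      change generator q p ^ (m * a) = _ * generator q s ^ a * _
      rw [← hpow, ← zpow_mul, ← hconj, conj_zpow]
      group
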